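/- Let $\lambda=(\lambda_n)_{n\ge1}$ be a sequence of real numbers with $\lambda_1>0$ and $\lambda_n\ge0$ for all $n$, and put $\Lambda_n:=\lambda_1+\dots+\lambda_n$. Assume that $\Lambda_n\to\infty$ and that the sequence $(\lambda_n/\Lambda_n)_{n\ge1}$ is nonincreasing with limit $\eta\in[0,1)$. For $p,q\in\mathbb R$, $x_1,\dots,x_n>0$ and weights $w_1,\dots,w_n\ge0$ with $w_1+\dots+w_n>0$, let $$\mathcal G_{p,q}(x,w):=\begin{cases}\left(\dfrac{w_1x_1^p+\dots+w_nx_n^p}{w_1x_1^q+\dots+w_nx_n^q}\right)^{\frac1{p-q}}, & p\ne q,\\[4mm] \exp\left(\dfrac{w_1x_1^p\log x_1+\dots+w_nx_n^p\log x_n}{w_1x_1^p+\dots+w_nx_n^p}\right), & p=q,\end{cases}$$ be the weighted Gini mean. Let $p,q$ satisfy $\min(p,q)\le0\le\max(p,q)<1$. Then the smallest $C\in[0,\infty]$ such that $$\sum_{n=1}^\infty\lambda_n\,\mathcal G_{p,q}\big((x_1,\dots,x_n),(\lambda_1,\dots,\lambda_n)\big)\le C\sum_{n=1}^\infty\lambda_nx_n\qquad\text{for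 all sequences }(x_n)\text{ of positive reals}$$ (the $\lambda$-weighted Hardy constant of $\mathcal G_{p,q}$) exists and equals $$\begin{cases}\left(\dfrac{1-(1-\eta)^{1-q}}{1-(1-\eta)^{1-p}}\right)^{\frac1{p-q}}, & \eta\in(0,1),\ p\ne q,\\[3mm] \left(\dfrac{1-q}{1-p}\right)^{\frac1{p-q}}, & \eta=0,\ p\ne q,\\[3mm] (1-\eta)^{1-1/\eta}, & \eta\in(0,1),\ p=q=0,\\[1mm] e, & \eta=0,\ p=q=0.\end{cases}$$ -/

import Mathlib

open Filter Topology

open scoped ENNReal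

/-- The set `W₀` of weight sequences: a positive first weight and nonnegative further weights.
Sequences are indexed from `0`, so `lam 0` is the first weight. -/
def weightSequences : Set (ℕ → ℝ) :=
  {lam | 0 < lam 0 ∧ ∀ n, 0 ≤ lam n}

/-- The sum of the first `n + 1` weights `lam 0 + ⋯ + lam n`. -/
def partialWeight (lam : ℕ → ℝ) (n : ℕ) : ℝ :=
  ∑ i ∈ Finset.range (n + 1), lam i

/-- The weighted Gini mean `G_{p,q}` of positive entries `x` with weights `w`. -/
noncomputable def giniMean (p q : ℝ) (n : ℕ) (x w : Fin n → ℝ) : ℝ :=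
  if p = q then
    Real.exp ((∑ i, w i * x i ^ p * Real.log (x i)) / ∑ i, w i * x i ^ p)
  else
    ((∑ i, w i * x i ^ p) / ∑ i, w i * x i ^ q) ^ (1 / (p - q))

/-- For `I` a set of nonnegative reals and `M` a weighted mean on `I`, the number `C` is the
`lam`-weighted Hardy constant of `M`: the smallest extended number with
`∑ lam_n M((x_1, …, x_n), (lam_1, …, lam_n)) ≤ C ∑ lam_n x_n` for all sequences `x` in `I`.
The series have nonnegative terms and are summed in `[0, ∞]`. -/
def IsHardyConstant (I : Set ℝ) (M : (n : ℕ) → (Fin n → ℝ) → (Fin n → ℝ) → ℝ)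
    (lam : ℕ → ℝ) (C : ℝ≥0∞) : Prop :=
  IsLeast
    {K : ℝ≥0∞ | ∀ x : ℕ → ℝ, (∀ n, x n ∈ I) →
      ∑' n, ENNReal.ofReal
          (lam n * M (n + 1) (fun i : Fin (n + 1) => x i) (fun i : Fin (n + 1) => lam i)) ≤
        K * ∑' n, ENNReal.ofReal (lam n * x n)}
    C

/-! For `q < p`, `c ≤ M(x)` iff `∑ w i * φ (x i / c) ≥ 0` with `φ t = t ^ p - t ^ q`; for `p = q =
0`, `φ = log`. The sign conditions on `p, q` make `φ` concave and increasing. Write `Λ` for the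
partial sums of the weights, `A` for the weighted arithmetic means of `x`, and `g n = Λ n *
M_n(1/Λ)`. The Hardy constant is `lim g`.

Upper bound: Kedlaya's inequality (`IsDeviationMean.kedlaya`) gives `∑_{k ≤ n} lam k * M_k(x) ≤ Λ n
* M_n(A)`. If `S = ∑ lam k * x k` is finite, then `A k ≤ S / Λ k`, so the right side is at most `g n
* S`.

Lower bound (`hardyConstant_lower_bound`): for `x = 1/Λ` the two series have terms `g k * (lam k / Λ
k)` and `lam k / Λ k`. As `∑ lam k / Λ k` diverges, the ratio of partial sums tends to `lim g`.

The limit itself is found by comparing `lam k * Λ k ^ (s - 1)` with the telescoping increments of `Λ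
^ s`, and likewise with those of `Λ * log Λ` for the geometric mean. -/

/-- The weighted mean of the initial segment `x 0, …, x n` with weights `lam 0, …, lam n`. -/
def prefixMean (M : (n : ℕ) → (Fin n → ℝ) → (Fin n → ℝ) → ℝ) (lam x : ℕ → ℝ) (n : ℕ) : ℝ :=
  M (n + 1) (fun i : Fin (n + 1) => x i) (fun i : Fin (n + 1) => lam i)

/-- `M` is the homogeneous deviation mean generated by `φ`: for positive entries and weights, `M`
is positive and is the largest `c > 0` with `0 ≤ ∑ w i * φ (x i / c)`. -/
def IsDeviationMean (φ : ℝ → ℝ) (M : (n : ℕ) → (Fin n → ℝ) → (Fin n → ℝ) → ℝ) : Prop :=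
  ∀ (n : ℕ) (x w : Fin (n + 1) → ℝ), (∀ i, 0 < x i) → (∀ i, 0 < w i) →
    0 < M (n + 1) x w ∧ ∀ c, 0 < c → (c ≤ M (n + 1) x w ↔ 0 ≤ ∑ i, w i * φ (x i / c))

/-! ### Deviation means and Kedlaya's inequality -/

section DeviationMean

variable {φ : ℝ → ℝ} {M : (n : ℕ) → (Fin n → ℝ) → (Fin n → ℝ) → ℝ} {lam : ℕ → ℝ}

lemma IsDeviationMean.prefixMean_pos (hM : IsDeviationMean φ M) (hlam : ∀ n, 0 < lam n)
    {x : ℕ → ℝ} (hx : ∀ n, 0 < x n) (n : ℕ) : 0 < prefixMean M lam x n :=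
  (hM n _ _ (fun i => hx i) (fun i => hlam i)).1

lemma IsDeviationMean.le_prefixMean_iff (hM : IsDeviationMean φ M) (hlam : ∀ n, 0 < lam n)
    {x : ℕ → ℝ} (hx : ∀ n, 0 < x n) (n : ℕ) {c : ℝ} (hc : 0 < c) :
    c ≤ prefixMean M lam x n ↔ 0 ≤ ∑ i ∈ Finset.range (n + 1), lam i * φ (x i / c) := by
  rw [Finset.sum_range]
  exact (hM n _ _ (fun i => hx i) (fun i => hlam i)).2 c hc

lemma IsDeviationMean.prefixMean_sum_nonneg (hM : IsDeviationMean φ M) (hlam : ∀ n, 0 < lam n)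
    {x : ℕ → ℝ} (hx : ∀ n, 0 < x n) (n : ℕ) :
    0 ≤ ∑ i ∈ Finset.range (n + 1), lam i * φ (x i / prefixMean M lam x n) :=
  (hM.le_prefixMean_iff hlam hx n (hM.prefixMean_pos hlam hx n)).1 le_rfl

lemma IsDeviationMean.prefixMean_mono (hM : IsDeviationMean φ M)
    (hφ : MonotoneOn φ (Set.Ioi 0)) (hlam : ∀ n, 0 < lam n) {x y : ℕ → ℝ} (hx : ∀ n, 0 < x n)
    (hxy : ∀ n, x n ≤ y n) (n : ℕ) : prefixMean M lam x n ≤ prefixMean M lam y n := by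
  have hy : ∀ n, 0 < y n := fun n => (hx n).trans_le (hxy n)
  have hc := hM.prefixMean_pos hlam hx n
  refine (hM.le_prefixMean_iff hlam hy n hc).2
    ((hM.prefixMean_sum_nonneg hlam hx n).trans (Finset.sum_le_sum fun i _ => ?_))
  refine mul_le_mul_of_nonneg_left (hφ (div_pos (hx i) hc) (div_pos (hy i) hc) ?_) (hlam i).le
  exact div_le_div_of_nonneg_right (hxy i) hc.le

lemma IsDeviationMean.prefixMean_mul_le (hM : IsDeviationMean φ M) (hlam : ∀ n, 0 < lam n)
    {x : ℕ → ℝ} (hx : ∀ n, 0 < x n) {t : ℝ} (ht : 0 < t) (n : ℕ) :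
    prefixMean M lam (fun k => t * x k) n ≤ t * prefixMean M lam x n := by
  have htx : ∀ n, 0 < t * x n := fun n => mul_pos ht (hx n)
  have hc := hM.prefixMean_pos hlam htx n
  have h := hM.prefixMean_sum_nonneg hlam htx n
  rw [← div_le_iff₀' ht, hM.le_prefixMean_iff hlam hx n (div_pos hc ht)]
  refine h.trans_eq (Finset.sum_congr rfl fun i _ => ?_)
  congr 2
  field_simp

lemma ConcaveOn.three_point_le (hφ : ConcaveOn ℝ (Set.Ioi 0) φ) {l a s t u v z : ℝ}
    (hl : 0 < l) (ha : 0 ≤ a) (hal : a ≤ l) (hs : 0 ≤ s) (ht : 0 ≤ t) (hst : s + t = 1)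
    (hu : 0 < u) (hv : 0 < v) (hz : 0 < z) {y : ℝ}
    (hy : l * y = s * (a * u + (l - a) * v) + t * (l * z)) :
    s * (a * φ u + (l - a) * φ v) + t * (l * φ z) ≤ l * φ y := by
  have hsum : a / l + (l - a) / l = 1 := by field_simp; ring
  have h0 : 0 ≤ a / l := div_nonneg ha hl.le
  have h1 : 0 ≤ (l - a) / l := div_nonneg (sub_nonneg.2 hal) hl.le
  have hin := hφ.2 (Set.mem_Ioi.2 hu) (Set.mem_Ioi.2 hv) h0 h1 hsum
  have hmem := hφ.1 (Set.mem_Ioi.2 hu) (Set.mem_Ioi.2 hv) h0 h1 hsum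
  have hout := hφ.2 hmem (Set.mem_Ioi.2 hz) hs ht hst
  simp only [smul_eq_mul] at hin hout
  have hyeq : s * (a / l * u + (l - a) / l * v) + t * z = y := by
    field_simp
    linarith
  rw [hyeq] at hout
  have h2 : s * (a / l * φ u + (l - a) / l * φ v) + t * φ z ≤ φ y :=
    (add_le_add_left (mul_le_mul_of_nonneg_left hin hs) _).trans hout
  calc s * (a * φ u + (l - a) * φ v) + t * (l * φ z)
      = l * (s * (a / l * φ u + (l - a) / l * φ v) + t * φ z) := by field_simp
    _ ≤ l * φ y := mul_le_mul_of_nonneg_left h2 hl.le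

/-- Collecting terms, `ψ j` with `j < n` receives `lam j - ρ * T j + ρ * T (j + 1) = (1 + ρ) * lam
j`, where `T` is the sum over `range`. The truncated `k - 1` at `k = 0` is harmless because `T 0 =
0`. -/
lemma sum_range_shifted_average (lam ψ : ℕ → ℝ) (ρ : ℝ) (n : ℕ) :
    ∑ k ∈ Finset.range (n + 1), (ρ * (∑ i ∈ Finset.range k, lam i) * ψ (k - 1) +
        (lam k - ρ * ∑ i ∈ Finset.range k, lam i) * ψ k) =
      (1 + ρ) * ∑ k ∈ Finset.range n, lam k * ψ k +
        (lam n - ρ * ∑ i ∈ Finset.range n, lam i) * ψ n := by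
  induction n with
  | zero => simp
  | succ n ih =>
    rw [Finset.sum_range_succ, ih, Finset.sum_range_succ (fun k => lam k * ψ k),
      Finset.sum_range_succ lam n, Nat.add_sub_cancel]
    ring

lemma partialWeight_pos (hlam : ∀ n, 0 < lam n) (n : ℕ) : 0 < partialWeight lam n :=
  Finset.sum_pos (fun i _ => hlam i) (by simp)

lemma partialWeight_succ (lam : ℕ → ℝ) (n : ℕ) :
    partialWeight lam (n + 1) = partialWeight lam n + lam (n + 1) :=
  Finset.sum_range_succ _ _

lemma sum_range_add_eq_partialWeight (lam : ℕ → ℝ) (n : ℕ) :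
    ∑ i ∈ Finset.range n, lam i + lam n = partialWeight lam n :=
  (Finset.sum_range_succ _ _).symm

/-- The weighted arithmetic mean of `x 0, …, x n`. -/
noncomputable def arithMean (lam x : ℕ → ℝ) (n : ℕ) : ℝ :=
  (∑ i ∈ Finset.range (n + 1), lam i * x i) / partialWeight lam n

lemma arithMean_pos (hlam : ∀ n, 0 < lam n) {x : ℕ → ℝ} (hx : ∀ n, 0 < x n) (n : ℕ) :
    0 < arithMean lam x n :=
  div_pos (Finset.sum_pos (fun i _ => mul_pos (hlam i) (hx i)) (by simp))
    (partialWeight_pos hlam n)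

lemma mul_eq_arithMean_sub (hlam : ∀ n, 0 < lam n) (x : ℕ → ℝ) (k : ℕ) :
    lam k * x k = partialWeight lam k * arithMean lam x k -
      (∑ i ∈ Finset.range k, lam i) * arithMean lam x (k - 1) := by
  have h : ∀ m, partialWeight lam m * arithMean lam x m =
      ∑ i ∈ Finset.range (m + 1), lam i * x i := fun m =>
    mul_div_cancel₀ _ (partialWeight_pos hlam m).ne'
  rw [h, Finset.sum_range_succ]
  cases k with
  | zero => simp
  | succ k =>
    have := h k
    simp only [partialWeight] at this
    rw [Nat.add_sub_cancel, this]
    ring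

/-- This is where monotonicity of `lam / Λ` enters: it makes the weights in the convex combination
of `kedlaya_step` nonnegative. -/
lemma mul_sum_range_le (hlam : ∀ n, 0 < lam n)
    (hanti : Antitone fun n => lam n / partialWeight lam n) {k n : ℕ} (hk : k ≤ n + 1) :
    lam (n + 1) / partialWeight lam n * ∑ i ∈ Finset.range k, lam i ≤ lam k := by
  have hL := partialWeight_pos hlam
  have h := hanti hk
  simp only at h
  rw [div_le_div_iff₀ (hL _) (hL _), partialWeight_succ,
    ← sum_range_add_eq_partialWeight lam k] at h
  rw [div_mul_eq_mul_div, div_le_iff₀ (hL n)]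
  linarith

/-- One step of Kedlaya's mixed mean inequality. -/
lemma IsDeviationMean.kedlaya_step (hM : IsDeviationMean φ M)
    (hφ : ConcaveOn ℝ (Set.Ioi 0) φ) (hlam : ∀ n, 0 < lam n)
    (hanti : Antitone fun n => lam n / partialWeight lam n) {x : ℕ → ℝ} (hx : ∀ n, 0 < x n)
    (n : ℕ) :
    partialWeight lam n * prefixMean M lam (arithMean lam x) n +
        lam (n + 1) * prefixMean M lam x (n + 1) ≤
      partialWeight lam (n + 1) * prefixMean M lam (arithMean lam x) (n + 1) := by
  have hA := arithMean_pos hlam hx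
  set A := arithMean lam x with hAdef
  have hL := partialWeight_pos hlam n
  have hl := hlam (n + 1)
  have hc1 := hM.prefixMean_pos hlam hA n
  have hc2 := hM.prefixMean_pos hlam hx (n + 1)
  have hS1 := hM.prefixMean_sum_nonneg hlam hA n
  have hS2 := hM.prefixMean_sum_nonneg hlam hx (n + 1)
  set c1 := prefixMean M lam A n
  set c2 := prefixMean M lam x (n + 1)
  set ρ := lam (n + 1) / partialWeight lam n with hρ
  have hρ0 : 0 < ρ := div_pos hl hL
  have hρL : lam (n + 1) = ρ * partialWeight lam n := by rw [hρ]; field_simp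
  have hd : 0 < c1 + ρ * c2 := by positivity
  have hc : 0 < (c1 + ρ * c2) / (1 + ρ) := by positivity
  suffices h : (c1 + ρ * c2) / (1 + ρ) ≤ prefixMean M lam A (n + 1) by
    rw [partialWeight_succ, hρL]
    rw [div_le_iff₀ (by positivity)] at h
    nlinarith
  rw [hM.le_prefixMean_iff hlam hA (n + 1) hc]
  set c := (c1 + ρ * c2) / (1 + ρ) with hcdef
  -- These weights satisfy `s / c1 = 1 / (c1 + ρ * c2)` and `t / c2 = ρ / (c1 + ρ * c2)`. In the
  -- combination below, the `A (k - 1)` part of `lam k * x k` then cancels and only a multiple of `A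
  -- k` remains.
  set s := c1 / (c1 + ρ * c2) with hs
  set t := ρ * c2 / (c1 + ρ * c2) with ht
  have hst : s + t = 1 := by rw [hs, ht]; field_simp
  have hs0 : 0 ≤ s := by positivity
  have ht0 : 0 ≤ t := by positivity
  have key : ∀ k ∈ Finset.range (n + 1 + 1),
      s * (ρ * (∑ i ∈ Finset.range k, lam i) * φ (A (k - 1) / c1) +
        (lam k - ρ * ∑ i ∈ Finset.range k, lam i) * φ (A k / c1)) +
        t * (lam k * φ (x k / c2)) ≤ lam k * φ (A k / c) := by
    intro k hk
    have hk' : k ≤ n + 1 := Nat.lt_succ_iff.1 (Finset.mem_range.1 hk)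
    refine hφ.three_point_le (hlam k)
      (mul_nonneg hρ0.le (Finset.sum_nonneg fun i _ => (hlam i).le))
      (mul_sum_range_le hlam hanti hk') hs0 ht0 hst
      (div_pos (hA _) hc1) (div_pos (hA _) hc1) (div_pos (hx _) hc2) ?_
    have h1 := mul_eq_arithMean_sub hlam x k
    rw [← sum_range_add_eq_partialWeight lam k, ← hAdef] at h1
    have h2 : lam k * (x k / c2) = (lam k * x k) / c2 := by ring
    rw [h2, h1, hs, ht, hcdef]
    field_simp
    ring
  refine le_trans ?_ (Finset.sum_le_sum key)
  rw [Finset.sum_add_distrib, ← Finset.mul_sum, ← Finset.mul_sum,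
    sum_range_shifted_average lam (fun k => φ (A k / c1)) ρ (n + 1)]
  -- The choice of `ρ` kills the boundary term, leaving nonnegative multiples of the two sums
  -- defining `c1` and `c2`.
  have h0 : lam (n + 1) - ρ * ∑ i ∈ Finset.range (n + 1), lam i = 0 :=
    sub_eq_zero.2 hρL
  rw [h0, zero_mul, add_zero]
  positivity

lemma IsDeviationMean.kedlaya (hM : IsDeviationMean φ M)
    (hφ : ConcaveOn ℝ (Set.Ioi 0) φ) (hlam : ∀ n, 0 < lam n)
    (hanti : Antitone fun n => lam n / partialWeight lam n) {x : ℕ → ℝ} (hx : ∀ n, 0 < x n)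
    (n : ℕ) :
    ∑ k ∈ Finset.range (n + 1), lam k * prefixMean M lam x k ≤
      partialWeight lam n * prefixMean M lam (arithMean lam x) n := by
  induction n with
  | zero =>
    have h : arithMean lam x 0 = x 0 := by
      simp [arithMean, partialWeight, (hlam 0).ne']
    have h' : prefixMean M lam (arithMean lam x) 0 = prefixMean M lam x 0 := by
      unfold prefixMean
      congr 1
      funext i
      have hi : (i : ℕ) = 0 := by omega
      rw [hi, h]
    rw [h']
    simp [partialWeight]
  | succ n ih =>
    rw [Finset.sum_range_succ]
    linarith [hM.kedlaya_step hφ hlam hanti hx n]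

end DeviationMean

/-! ### Weighted Cesàro means and divergence -/

lemma tendsto_weighted_average {f b : ℕ → ℝ} {l : ℝ} (hb : ∀ n, 0 ≤ b n)
    (hsum : Tendsto (fun n => ∑ k ∈ Finset.range n, b k) atTop atTop)
    (hf : Tendsto f atTop (𝓝 l)) :
    Tendsto (fun n => (∑ k ∈ Finset.range n, f k * b k) / ∑ k ∈ Finset.range n, b k)
      atTop (𝓝 l) := by
  have ho : (fun n => (f n - l) * b n) =o[atTop] b := by
    have h : (fun n => f n - l) =o[atTop] (fun _ => (1 : ℝ)) := by
      rw [Asymptotics.isLittleO_one_iff]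
      simpa using hf.sub_const l
    simpa using h.mul_isBigO (Asymptotics.isBigO_refl b atTop)
  have h := (ho.sum_range hb hsum).tendsto_div_nhds_zero.add_const l
  rw [zero_add] at h
  refine h.congr' ?_
  filter_upwards [hsum.eventually_gt_atTop 0] with n hn
  have : ∑ k ∈ Finset.range n, (f k - l) * b k =
      ∑ k ∈ Finset.range n, f k * b k - l * ∑ k ∈ Finset.range n, b k := by
    rw [Finset.mul_sum, ← Finset.sum_sub_distrib]
    exact Finset.sum_congr rfl fun k _ => by ring
  rw [this]
  field_simp
  ring

/-- Abel and Dini: `∑ lam n / Λ n` diverges together with `∑ lam n`. -/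
lemma tendsto_sum_div_partialWeight {lam : ℕ → ℝ} (hlam : ∀ n, 0 < lam n)
    (hdiv : Tendsto (partialWeight lam) atTop atTop) :
    Tendsto (fun n => ∑ k ∈ Finset.range n, lam k / partialWeight lam k) atTop atTop := by
  have hL := partialWeight_pos hlam
  have h0 : ∀ n, 0 ≤ lam n / partialWeight lam n := fun n => (div_pos (hlam n) (hL n)).le
  rw [← not_summable_iff_tendsto_nat_atTop_of_nonneg h0]
  intro hs
  have htail := (tendsto_sum_nat_add fun n => lam n / partialWeight lam n)
  -- A tail below `1 / 2` would force `Λ (m + n) ≤ 2 * Λ m` for all `n`.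
  obtain ⟨m, hm⟩ := (htail.eventually_lt_const (show (0 : ℝ) < 1 / 2 by norm_num)).exists
  have hmono : Monotone (partialWeight lam) := monotone_nat_of_le_succ fun n => by
    rw [partialWeight_succ]; linarith [hlam (n + 1)]
  have hbound : ∀ n, (partialWeight lam (m + n) - partialWeight lam m) ≤
      partialWeight lam (m + n) *
        ∑ k ∈ Finset.range (n + 1), lam (k + m) / partialWeight lam (k + m) := by
    intro n
    rw [Finset.mul_sum]
    have h1 : partialWeight lam (m + n) - partialWeight lam m ≤
        ∑ k ∈ Finset.range (n + 1), lam (k + m) := by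
      induction n with
      | zero => simp [(hlam m).le]
      | succ n ih =>
        rw [Finset.sum_range_succ, ← add_assoc, partialWeight_succ,
          show n + 1 + m = m + n + 1 by ring]
        linarith
    refine h1.trans (Finset.sum_le_sum fun k hk => ?_)
    have hk' : k ≤ n := Nat.lt_succ_iff.1 (Finset.mem_range.1 hk)
    rw [mul_div_assoc', le_div_iff₀ (hL _), mul_comm]
    exact mul_le_mul_of_nonneg_right (hmono (by omega)) (hlam _).le
  obtain ⟨N, hN⟩ := ((hdiv.eventually_gt_atTop (2 * partialWeight lam m)).and
    (eventually_ge_atTop m)).exists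
  obtain ⟨n, rfl⟩ := Nat.exists_eq_add_of_le hN.2
  have h2 := ((summable_nat_add_iff m).2 hs).sum_le_tsum (Finset.range (n + 1))
    (fun k _ => h0 (k + m))
  have h3 := hbound n
  have h4 := mul_le_mul_of_nonneg_left (h2.trans hm.le) (hL (m + n)).le
  linarith [hN.1]

/-! ### The Hardy constant of a concave deviation mean -/

section HardyConstant

variable {φ : ℝ → ℝ} {M : (n : ℕ) → (Fin n → ℝ) → (Fin n → ℝ) → ℝ} {lam : ℕ → ℝ} {C : ℝ}

lemma IsDeviationMean.hardy_inequality (hM : IsDeviationMean φ M)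
    (hφ : ConcaveOn ℝ (Set.Ioi 0) φ) (hφm : MonotoneOn φ (Set.Ioi 0)) (hlam : ∀ n, 0 < lam n)
    (hanti : Antitone fun n => lam n / partialWeight lam n) (hC : 0 < C)
    (hlim : Tendsto (fun n => partialWeight lam n *
      prefixMean M lam (fun k => (partialWeight lam k)⁻¹) n) atTop (𝓝 C))
    {x : ℕ → ℝ} (hx : ∀ n, 0 < x n) :
    ∑' n, ENNReal.ofReal (lam n * prefixMean M lam x n) ≤
      ENNReal.ofReal C * ∑' n, ENNReal.ofReal (lam n * x n) := by
  have hL := partialWeight_pos hlam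
  have hlx : ∀ n, 0 < lam n * x n := fun n => mul_pos (hlam n) (hx n)
  by_cases hfin : ∑' n, ENNReal.ofReal (lam n * x n) = ⊤
  · rw [hfin, ENNReal.mul_top (by simpa using hC)]
    exact le_top
  have hsum : Summable fun n => lam n * x n := by
    have := ENNReal.summable_toReal hfin
    simpa [ENNReal.toReal_ofReal (hlx _).le] using this
  rw [← ENNReal.ofReal_tsum_of_nonneg (fun n => (hlx n).le) hsum,
    ← ENNReal.ofReal_mul hC.le]
  set S := ∑' n, lam n * x n
  have hS : 0 < S := hsum.tsum_pos (fun n => (hlx n).le) 0 (hlx 0)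
  have hbound : ∀ n, ∑ k ∈ Finset.range (n + 1), lam k * prefixMean M lam x k ≤
      (partialWeight lam n * prefixMean M lam (fun k => (partialWeight lam k)⁻¹) n) * S := by
    intro n
    have hle : ∀ k, arithMean lam x k ≤ S * (partialWeight lam k)⁻¹ := fun k => by
      rw [arithMean, div_eq_mul_inv]
      exact mul_le_mul_of_nonneg_right (hsum.sum_le_tsum _ fun i _ => (hlx i).le)
        (inv_nonneg.2 (hL k).le)
    calc _ ≤ _ := hM.kedlaya hφ hlam hanti hx n
      _ ≤ partialWeight lam n *
          (S * prefixMean M lam (fun k => (partialWeight lam k)⁻¹) n) :=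
        mul_le_mul_of_nonneg_left ((hM.prefixMean_mono hφm hlam (arithMean_pos hlam hx) hle n).trans
          (hM.prefixMean_mul_le hlam (fun k => inv_pos.2 (hL k)) hS n)) (hL n).le
      _ = _ := by ring
  refine le_of_tendsto_of_tendsto'
    ((ENNReal.tendsto_nat_tsum fun n => ENNReal.ofReal (lam n * prefixMean M lam x n)).comp
      (tendsto_add_atTop_nat 1)) (ENNReal.tendsto_ofReal (hlim.mul_const S)) fun n => ?_
  simp only [Function.comp]
  rw [← ENNReal.ofReal_sum_of_nonneg fun k _ =>
    (mul_pos (hlam k) (hM.prefixMean_pos hlam hx k)).le]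
  exact ENNReal.ofReal_le_ofReal (hbound n)

lemma hardyConstant_lower_bound (hlam : ∀ n, 0 < lam n)
    (hdiv : Tendsto (partialWeight lam) atTop atTop)
    (hM : ∀ x : ℕ → ℝ, (∀ n, 0 < x n) → ∀ n, 0 < prefixMean M lam x n)
    (hlim : Tendsto (fun n => partialWeight lam n *
      prefixMean M lam (fun k => (partialWeight lam k)⁻¹) n) atTop (𝓝 C))
    {K : ℝ≥0∞} (hK : ∀ x : ℕ → ℝ, (∀ n, 0 < x n) →
      ∑' n, ENNReal.ofReal (lam n * prefixMean M lam x n) ≤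
        K * ∑' n, ENNReal.ofReal (lam n * x n)) : ENNReal.ofReal C ≤ K := by
  have hL := partialWeight_pos hlam
  rcases eq_or_ne K ⊤ with rfl | hKtop
  · exact le_top
  set g := fun n => partialWeight lam n *
      prefixMean M lam (fun k => (partialWeight lam k)⁻¹) n with hg
  set r := fun n => lam n / partialWeight lam n with hr
  have hr0 : ∀ n, 0 < r n := fun n => div_pos (hlam n) (hL n)
  have hr1 : ∀ n, r n ≤ 1 := fun n => by
    rw [hr, div_le_one (hL n), ← sum_range_add_eq_partialWeight]
    linarith [Finset.sum_nonneg (s := Finset.range n) fun i _ => (hlam i).le]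
  have hD := tendsto_sum_div_partialWeight hlam hdiv
  have hbound : ∀ N, ∑ k ∈ Finset.range N, g k * r k ≤
      K.toReal * (∑ k ∈ Finset.range N, r k + 2) := by
    intro N
    -- Entries must stay positive, so `1/Λ` is damped geometrically from `N` on instead of being cut
    -- off; this adds at most `2` to the sum.
    set x : ℕ → ℝ := fun k => if k < N then (partialWeight lam k)⁻¹ else
      (1 / 2) ^ k * (partialWeight lam k)⁻¹ with hxdef
    have hx : ∀ n, 0 < x n := fun n => by
      have := hL n
      simp only [hxdef]
      split_ifs <;> positivity
    have hlx : ∀ n, 0 ≤ lam n * x n := fun n => (mul_pos (hlam n) (hx n)).le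
    have hle : ∀ n, lam n * x n ≤ (if n ∈ Finset.range N then r n else 0) + (1 / 2) ^ n := by
      intro n
      have h2 : (0 : ℝ) < (1 / 2) ^ n := by positivity
      simp only [hxdef, Finset.mem_range]
      split_ifs with h
      · rw [← div_eq_mul_inv]
        change r n ≤ _
        linarith
      · have := mul_le_mul_of_nonneg_left (hr1 n) h2.le
        simp only [hr, div_eq_mul_inv] at this
        simp only [one_div] at *
        linarith
    have hs1 : HasSum (fun n => if n ∈ Finset.range N then r n else 0)
        (∑ k ∈ Finset.range N, r k) := by
      have : HasSum _ _ := hasSum_sum_of_ne_finset_zero (f := fun n => if n ∈ Finset.range N then r n else 0)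
        (s := Finset.range N) (fun b hb => if_neg hb)
      rwa [Finset.sum_congr rfl fun k hk => if_pos hk] at this
    have hs2 := hs1.add hasSum_geometric_two
    have hsum : Summable fun n => lam n * x n := hs2.summable.of_nonneg_of_le hlx hle
    have hmain := (ENNReal.sum_le_tsum (Finset.range N)).trans (hK x hx)
    rw [← ENNReal.ofReal_sum_of_nonneg fun k _ => (mul_pos (hlam k) (hM x hx k)).le,
      ← ENNReal.ofReal_tsum_of_nonneg hlx hsum, ← ENNReal.ofReal_toReal hKtop,
      ← ENNReal.ofReal_mul ENNReal.toReal_nonneg,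
      ENNReal.ofReal_le_ofReal_iff (mul_nonneg ENNReal.toReal_nonneg (tsum_nonneg hlx))] at hmain
    calc ∑ k ∈ Finset.range N, g k * r k
        = ∑ k ∈ Finset.range N, lam k * prefixMean M lam x k := by
          refine Finset.sum_congr rfl fun k hk => ?_
          have hk' := Finset.mem_range.1 hk
          have : prefixMean M lam x k =
              prefixMean M lam (fun k => (partialWeight lam k)⁻¹) k := by
            unfold prefixMean
            congr 1
            funext i
            exact if_pos (lt_of_le_of_lt (Nat.lt_succ_iff.1 i.2) hk')
          rw [this, hg, hr]
          have := (hL k).ne'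
          field_simp
      _ ≤ _ := hmain
      _ ≤ _ := mul_le_mul_of_nonneg_left
          ((hsum.tsum_le_tsum hle hs2.summable).trans_eq hs2.tsum_eq) ENNReal.toReal_nonneg
  rw [← ENNReal.ofReal_toReal hKtop]
  refine ENNReal.ofReal_le_ofReal ?_
  have h1 : Tendsto (fun N => (∑ k ∈ Finset.range N, g k * r k) / ∑ k ∈ Finset.range N, r k)
      atTop (𝓝 C) := tendsto_weighted_average (fun n => (hr0 n).le) hD hlim
  have h2 : Tendsto (fun N => K.toReal * (1 + 2 / ∑ k ∈ Finset.range N, r k)) atTop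
      (𝓝 (K.toReal * (1 + 0))) :=
    ((hD.const_div_atTop 2).const_add 1).const_mul _
  rw [add_zero, mul_one] at h2
  refine le_of_tendsto_of_tendsto h1 h2 ?_
  filter_upwards [hD.eventually_gt_atTop 0] with N hN
  change 0 < ∑ k ∈ Finset.range N, r k at hN
  rw [div_le_iff₀ hN]
  refine (hbound N).trans_eq ?_
  field_simp

theorem IsDeviationMean.isHardyConstant (hM : IsDeviationMean φ M)
    (hφ : ConcaveOn ℝ (Set.Ioi 0) φ) (hφm : MonotoneOn φ (Set.Ioi 0)) (hlam : ∀ n, 0 < lam n)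
    (hdiv : Tendsto (partialWeight lam) atTop atTop)
    (hanti : Antitone fun n => lam n / partialWeight lam n) (hC : 0 < C)
    (hlim : Tendsto (fun n => partialWeight lam n *
      prefixMean M lam (fun k => (partialWeight lam k)⁻¹) n) atTop (𝓝 C)) :
    IsHardyConstant (Set.Ioi 0) M lam (ENNReal.ofReal C) :=
  ⟨fun _ hx => hM.hardy_inequality hφ hφm hlam hanti hC hlim hx, fun _ hK =>
    hardyConstant_lower_bound hlam hdiv (fun _ hx => hM.prefixMean_pos hlam hx) hlim hK⟩

end HardyConstant

/-! ### Gini means as deviation means -/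

lemma giniMean_comm (p q : ℝ) (n : ℕ) (x w : Fin n → ℝ) (hx : ∀ i, 0 < x i)
    (hw : ∀ i, 0 ≤ w i) : giniMean p q n x w = giniMean q p n x w := by
  rcases eq_or_ne p q with rfl | hpq
  · rfl
  · have hs : ∀ r : ℝ, 0 ≤ ∑ i, w i * x i ^ r := fun r =>
      Finset.sum_nonneg fun i _ => mul_nonneg (hw i) (Real.rpow_nonneg (hx i).le _)
    rw [giniMean, giniMean, if_neg hpq, if_neg hpq.symm, ← inv_div, Real.inv_rpow
      (div_nonneg (hs _) (hs _)), ← Real.rpow_neg (div_nonneg (hs _) (hs _)), ← neg_sub q p,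
      div_neg, neg_neg]

lemma isDeviationMean_giniMean {p q : ℝ} (hqp : q < p) :
    IsDeviationMean (fun t => t ^ p - t ^ q) (giniMean p q) := by
  intro n x w hx hw
  have hs : ∀ r : ℝ, 0 < ∑ i, w i * x i ^ r := fun r =>
    Finset.sum_pos (fun i _ => mul_pos (hw i) (Real.rpow_pos_of_pos (hx i) _))
      Finset.univ_nonempty
  have hpq : 0 < p - q := sub_pos.2 hqp
  have hdiv := div_pos (hs p) (hs q)
  rw [giniMean, if_neg hqp.ne', one_div]
  refine ⟨Real.rpow_pos_of_pos hdiv _, fun c hc => ?_⟩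
  have hcr : ∀ r : ℝ, 0 < c ^ r := fun r => Real.rpow_pos_of_pos hc r
  have hsum : ∑ i, w i * ((x i / c) ^ p - (x i / c) ^ q) =
      (∑ i, w i * x i ^ p) / c ^ p - (∑ i, w i * x i ^ q) / c ^ q := by
    rw [Finset.sum_div, Finset.sum_div, ← Finset.sum_sub_distrib]
    refine Finset.sum_congr rfl fun i _ => ?_
    rw [Real.div_rpow (hx i).le hc.le, Real.div_rpow (hx i).le hc.le]
    ring
  rw [hsum, sub_nonneg, Real.le_rpow_inv_iff_of_pos hc.le hdiv.le hpq, Real.rpow_sub hc,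
    div_le_div_iff₀ (hcr q) (hs q), div_le_div_iff₀ (hcr q) (hcr p), mul_comm (c ^ p)]

lemma isDeviationMean_giniMean_zero : IsDeviationMean Real.log (giniMean 0 0) := by
  intro n x w hx hw
  have hs : 0 < ∑ i, w i := Finset.sum_pos (fun i _ => hw i) Finset.univ_nonempty
  rw [giniMean, if_pos rfl]
  refine ⟨Real.exp_pos _, fun c hc => ?_⟩
  have hsum : ∑ i, w i * Real.log (x i / c) =
      ∑ i, w i * Real.log (x i) - Real.log c * ∑ i, w i := by
    rw [Finset.mul_sum, ← Finset.sum_sub_distrib]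
    refine Finset.sum_congr rfl fun i _ => ?_
    rw [Real.log_div (hx i).ne' hc.ne']
    ring
  simp only [Real.rpow_zero, mul_one]
  rw [hsum, sub_nonneg, ← Real.log_le_iff_le_exp hc, le_div_iff₀ hs]

/-- `t ^ q = exp (q * log t)` is the increasing convex `exp` applied to a convex function. -/
lemma convexOn_rpow_of_nonpos {q : ℝ} (hq : q ≤ 0) :
    ConvexOn ℝ (Set.Ioi 0) fun t : ℝ => t ^ q := by
  have h : ConvexOn ℝ (Set.Ioi 0) fun t : ℝ => -q * -Real.log t :=
    strictConcaveOn_log_Ioi.concaveOn.neg.smul (neg_nonneg.2 hq)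
  refine ⟨convex_Ioi 0, fun x hx y hy a b ha hb hab => ?_⟩
  have h1 := h.2 hx hy ha hb hab
  have h2 := convexOn_exp.2 (Set.mem_univ (-q * -Real.log x)) (Set.mem_univ (-q * -Real.log y))
    ha hb hab
  have h3 := (Real.exp_le_exp.2 h1).trans h2
  simp only [neg_mul_neg, mul_comm q] at h3
  rwa [← Real.rpow_def_of_pos hx, ← Real.rpow_def_of_pos hy,
    ← Real.rpow_def_of_pos (convex_Ioi (0 : ℝ) hx hy ha hb hab)] at h3

lemma concaveOn_rpow_sub_rpow {p q : ℝ} (hq : q ≤ 0) (hp0 : 0 ≤ p) (hp1 : p ≤ 1) :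
    ConcaveOn ℝ (Set.Ioi 0) fun t : ℝ => t ^ p - t ^ q :=
  ((Real.concaveOn_rpow hp0 hp1).subset Set.Ioi_subset_Ici_self (convex_Ioi 0)).sub
    (convexOn_rpow_of_nonpos hq)

lemma monotoneOn_rpow_sub_rpow {p q : ℝ} (hq : q ≤ 0) (hp0 : 0 ≤ p) :
    MonotoneOn (fun t : ℝ => t ^ p - t ^ q) (Set.Ioi 0) := fun _ hx _ _ hxy =>
  sub_le_sub (Real.rpow_le_rpow (le_of_lt hx) hxy hp0) (Real.rpow_le_rpow_of_nonpos hx hxy hq)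

/-! ### Asymptotics of the means of `1/Λ` -/

section Weights

variable {lam : ℕ → ℝ}

/-- A zero weight would, by monotonicity of `lam / Λ`, make all later weights zero and `Λ` bounded.
-/
lemma weight_pos (hlam : lam ∈ weightSequences)
    (hdiv : Tendsto (partialWeight lam) atTop atTop)
    (hanti : Antitone fun n => lam n / partialWeight lam n) (n : ℕ) : 0 < lam n := by
  have hL : ∀ m, 0 < partialWeight lam m := fun m =>
    Finset.sum_pos' (fun i _ => hlam.2 i) ⟨0, by simp, hlam.1⟩
  refine (hlam.2 n).lt_of_ne' fun h0 => ?_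
  have hz : ∀ m, n ≤ m → lam m = 0 := fun m hm => by
    have h := hanti hm
    simp only [h0, zero_div] at h
    have := mul_nonpos_of_nonpos_of_nonneg h (hL m).le
    rw [div_mul_cancel₀ _ (hL m).ne'] at this
    exact le_antisymm this (hlam.2 m)
  have hconst : ∀ m, n ≤ m → partialWeight lam m = partialWeight lam n := fun m hm => by
    induction m, hm using Nat.le_induction with
    | base => rfl
    | succ m hm ih => rw [partialWeight_succ, ih, hz _ (by omega), add_zero]
  obtain ⟨m, hm1, hm2⟩ := ((hdiv.eventually_gt_atTop (partialWeight lam n)).and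
    (eventually_ge_atTop n)).exists
  exact hm1.ne' (hconst m hm2)

/-- The limit of `Λ_n ^ (-s) * ∑ lam k * Λ_k ^ (s - 1)` when `lam n / Λ n` tends to `η`. -/
noncomputable def powerConstant (η s : ℝ) : ℝ :=
  if η = 0 then 1 / s else η / (1 - (1 - η) ^ s)

lemma one_sub_rpow_pos {η s : ℝ} (hη0 : 0 < η) (hη1 : η ≤ 1) (hs : 0 < s) :
    0 < 1 - (1 - η) ^ s :=
  sub_pos.2 (Real.rpow_lt_one (by linarith) (by linarith) hs)

lemma powerConstant_pos {η s : ℝ} (hη0 : 0 ≤ η) (hη1 : η ≤ 1) (hs : 0 < s) :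
    0 < powerConstant η s := by
  unfold powerConstant
  split_ifs with h
  · positivity
  · have hη := hη0.lt_of_ne' h
    exact div_pos hη (one_sub_rpow_pos hη hη1 hs)

/-- For `η = 0` the limit is the inverse of the derivative `s` of `1 - (1 - t) ^ s` at `0`. -/
lemma tendsto_div_one_sub_rpow {η s : ℝ} (hη0 : 0 ≤ η) (hη1 : η < 1) (hs : 0 < s)
    {r : ℕ → ℝ} (hr0 : ∀ n, 0 < r n) (hr : Tendsto r atTop (𝓝 η)) :
    Tendsto (fun n => r n / (1 - (1 - r n) ^ s)) atTop (𝓝 (powerConstant η s)) := by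
  unfold powerConstant
  split_ifs with h
  · subst h
    have hd : HasDerivAt (fun t : ℝ => 1 - (1 - t) ^ s) s 0 := by
      have h1 : HasDerivAt (fun t : ℝ => 1 - t) (-1) 0 := by
        simpa using (hasDerivAt_id (0 : ℝ)).const_sub 1
      simpa using (h1.rpow_const (p := s) (Or.inl (by norm_num))).const_sub 1
    have hr' : Tendsto r atTop (𝓝[≠] 0) :=
      tendsto_nhdsWithin_iff.2 ⟨hr, Eventually.of_forall fun n => (hr0 n).ne'⟩
    have h2 := ((hasDerivAt_iff_tendsto_slope.1 hd).comp hr').inv₀ hs.ne'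
    rw [one_div]
    refine h2.congr fun n => ?_
    simp [slope_def_field]
  · have hη := hη0.lt_of_ne' h
    refine hr.div ?_ (one_sub_rpow_pos hη hη1.le hs).ne'
    exact ((hr.const_sub 1).rpow_const (Or.inr hs.le)).const_sub 1

/-- With `r = lam / Λ`, each term is `r k / (1 - (1 - r k) ^ s)` times the increment of `Λ ^ s`, so
the quotient is a weighted average of a convergent sequence. -/
lemma tendsto_power_average (hlam : ∀ n, 0 < lam n)
    (hdiv : Tendsto (partialWeight lam) atTop atTop) {η s : ℝ} (hη0 : 0 ≤ η) (hη1 : η < 1)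
    (hlim : Tendsto (fun n => lam n / partialWeight lam n) atTop (𝓝 η)) (hs : 0 < s) :
    Tendsto (fun n => (∑ k ∈ Finset.range (n + 1), lam k * partialWeight lam k ^ (s - 1)) /
      partialWeight lam n ^ s) atTop (𝓝 (powerConstant η s)) := by
  have hL := partialWeight_pos hlam
  set T : ℕ → ℝ := fun n => ∑ i ∈ Finset.range n, lam i with hT
  have hT0 : ∀ n, 0 ≤ T n := fun n => Finset.sum_nonneg fun i _ => (hlam i).le
  have hTL : ∀ n, T (n + 1) = partialWeight lam n := fun n => rfl
  have hTs : ∀ n, T n + lam n = partialWeight lam n := sum_range_add_eq_partialWeight lam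
  have hr0 : ∀ n, 0 < lam n / partialWeight lam n := fun n => div_pos (hlam n) (hL n)
  have hb : ∀ n, 0 ≤ T (n + 1) ^ s - T n ^ s := fun n =>
    sub_nonneg.2 (Real.rpow_le_rpow (hT0 n) (by rw [hTL, ← hTs]; linarith [hlam n]) hs.le)
  have hsum : ∀ n, ∑ k ∈ Finset.range n, (T (k + 1) ^ s - T k ^ s) = T n ^ s := fun n => by
    rw [Finset.sum_range_sub (fun k => T k ^ s)]
    simp [hT, Real.zero_rpow hs.ne']
  have hTtop : Tendsto (fun n => T n ^ s) atTop atTop :=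
    (tendsto_add_atTop_iff_nat 1).1 ((tendsto_rpow_atTop hs).comp hdiv)
  have h := (tendsto_weighted_average hb (by simpa only [hsum] using hTtop)
    (tendsto_div_one_sub_rpow hη0 hη1 hs hr0 hlim)).comp (tendsto_add_atTop_nat 1)
  refine h.congr fun n => ?_
  simp only [Function.comp]
  rw [hsum, hTL]
  congr 1
  refine Finset.sum_congr rfl fun k _ => ?_
  have h1 : 1 - lam k / partialWeight lam k = T k / partialWeight lam k := by
    rw [← hTs k, eq_div_iff (by rw [hTs]; exact (hL k).ne'), sub_mul,
      div_mul_cancel₀ _ (by rw [hTs]; exact (hL k).ne')]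
    ring
  have hle : lam k / partialWeight lam k ≤ 1 := by
    linarith [div_nonneg (hT0 k) (hL k).le]
  have h2 := (one_sub_rpow_pos (hr0 k) hle hs).ne'
  have h3 : partialWeight lam k ^ s - T k ^ s =
      partialWeight lam k ^ s * (1 - (1 - lam k / partialWeight lam k) ^ s) := by
    rw [h1, Real.div_rpow (hT0 k) (hL k).le, mul_sub, mul_div_cancel₀ _
      (Real.rpow_pos_of_pos (hL k) s).ne', mul_one]
  rw [hTL, h3, Real.rpow_sub_one (hL k).ne']
  generalize 1 - (1 - lam k / partialWeight lam k) ^ s = d at h2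
  have := (hL k).ne'
  field_simp

/-- The sums in the mean are power averages with `s = 1 - p` and `s = 1 - q`, and the factor `Λ n`
supplies exactly their normalisation. -/
lemma tendsto_giniMean_inv_partialWeight (hlam : ∀ n, 0 < lam n)
    (hdiv : Tendsto (partialWeight lam) atTop atTop) {η p q : ℝ} (hη0 : 0 ≤ η) (hη1 : η < 1)
    (hlim : Tendsto (fun n => lam n / partialWeight lam n) atTop (𝓝 η))
    (hqp : q < p) (hp1 : p < 1) :
    Tendsto (fun n => partialWeight lam n *
      prefixMean (giniMean p q) lam (fun k => (partialWeight lam k)⁻¹) n) atTop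
      (𝓝 ((powerConstant η (1 - p) / powerConstant η (1 - q)) ^ (1 / (p - q)))) := by
  have hL := partialWeight_pos hlam
  have hpq : 0 < p - q := sub_pos.2 hqp
  have hP := tendsto_power_average hlam hdiv hη0 hη1 hlim (sub_pos.2 hp1)
  have hQ := tendsto_power_average hlam hdiv hη0 hη1 hlim (sub_pos.2 (hqp.trans hp1))
  have h := (hP.div hQ (powerConstant_pos hη0 hη1.le (sub_pos.2 (hqp.trans hp1))).ne').rpow_const
    (p := 1 / (p - q)) (Or.inr (by positivity))
  refine h.congr fun n => ?_
  have hsum : ∀ r : ℝ, ∑ i : Fin (n + 1), lam i * ((partialWeight lam i)⁻¹) ^ r =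
      ∑ k ∈ Finset.range (n + 1), lam k * partialWeight lam k ^ (1 - r - 1) := fun r => by
    rw [Finset.sum_range]
    refine Finset.sum_congr rfl fun i _ => ?_
    rw [Real.inv_rpow (hL _).le, ← Real.rpow_neg (hL _).le]
    congr 2
    ring
  have hpos : ∀ r : ℝ, 0 < ∑ k ∈ Finset.range (n + 1), lam k * partialWeight lam k ^ r :=
    fun r => Finset.sum_pos (fun i _ => mul_pos (hlam i) (Real.rpow_pos_of_pos (hL i) _)) (by simp)
  rw [prefixMean, giniMean, if_neg hqp.ne', hsum, hsum]
  have hLr : ∀ r : ℝ, 0 < partialWeight lam n ^ r := fun r => Real.rpow_pos_of_pos (hL n) r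
  have h1 : partialWeight lam n = (partialWeight lam n ^ (p - q)) ^ (1 / (p - q)) := by
    rw [← Real.rpow_mul (hL n).le, mul_one_div_cancel hpq.ne', Real.rpow_one]
  conv_rhs => rw [h1]
  rw [← Real.mul_rpow (hLr _).le (div_pos (hpos _) (hpos _)).le]
  congr 1
  have h2 : partialWeight lam n ^ (1 - q) =
      partialWeight lam n ^ (p - q) * partialWeight lam n ^ (1 - p) := by
    rw [← Real.rpow_add (hL n)]
    congr 1
    ring
  simp only [Pi.div_apply]
  rw [h2]
  have := (hLr (1 - p)).ne'
  have := (hLr (p - q)).ne'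
  have := (hpos (1 - q - 1)).ne'
  field_simp

/-- The logarithm of the Hardy constant of the geometric mean. -/
lemma tendsto_log_average (hlam : ∀ n, 0 < lam n)
    (hdiv : Tendsto (partialWeight lam) atTop atTop) {η : ℝ} (hη0 : 0 ≤ η) (hη1 : η < 1)
    (hlim : Tendsto (fun n => lam n / partialWeight lam n) atTop (𝓝 η)) :
    Tendsto (fun n => Real.log (partialWeight lam n) -
        (∑ k ∈ Finset.range (n + 1), lam k * Real.log (partialWeight lam k)) /
          partialWeight lam n) atTop
      (𝓝 (if η = 0 then 1 else (1 - 1 / η) * Real.log (1 - η))) := by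
  have hL := partialWeight_pos hlam
  set T : ℕ → ℝ := fun n => ∑ i ∈ Finset.range n, lam i with hT
  have hT0 : ∀ n, 0 ≤ T n := fun n => Finset.sum_nonneg fun i _ => (hlam i).le
  have hTL : ∀ n, T (n + 1) = partialWeight lam n := fun n => rfl
  have hTs : ∀ n, T n + lam n = partialWeight lam n := sum_range_add_eq_partialWeight lam
  have hr0 : ∀ n, 0 < lam n / partialWeight lam n := fun n => div_pos (hlam n) (hL n)
  have hf : Tendsto (fun n => -((1 - lam n / partialWeight lam n) *
      Real.log (1 - lam n / partialWeight lam n) / (lam n / partialWeight lam n))) atTop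
      (𝓝 (if η = 0 then 1 else (1 - 1 / η) * Real.log (1 - η))) := by
    set r := fun n => lam n / partialWeight lam n
    split_ifs with h
    · subst h
      have hd : HasDerivAt (fun t : ℝ => -((1 - t) * Real.log (1 - t))) 1 0 := by
        have h1 : HasDerivAt (fun t : ℝ => 1 - t) (-1) 0 := by
          simpa using (hasDerivAt_id (0 : ℝ)).const_sub 1
        simpa using (h1.fun_mul (h1.log (by norm_num))).fun_neg
      have hr' : Tendsto r atTop (𝓝[≠] 0) :=
        tendsto_nhdsWithin_iff.2 ⟨hlim, Eventually.of_forall fun n => (hr0 n).ne'⟩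
      refine ((hasDerivAt_iff_tendsto_slope.1 hd).comp hr').congr fun n => ?_
      simp [slope_def_field, r, neg_div]
    · have h1 := hlim.const_sub 1
      have h2 := ((h1.mul (h1.log (sub_pos.2 hη1).ne')).div hlim h).neg
      have h3 : -((1 - η) * Real.log (1 - η) / η) = (1 - 1 / η) * Real.log (1 - η) := by
        field_simp
        ring
      exact h3 ▸ h2
  have h := (tendsto_weighted_average (fun n => (hlam n).le)
    ((tendsto_add_atTop_iff_nat 1).1 hdiv) hf).comp (tendsto_add_atTop_nat 1)
  refine h.congr fun n => ?_
  simp only [Function.comp]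
  -- Discrete product rule: the increments of `T * log T` telescope.
  have hterm : ∀ k, -((1 - lam k / partialWeight lam k) *
      Real.log (1 - lam k / partialWeight lam k) / (lam k / partialWeight lam k)) * lam k =
      (T (k + 1) * Real.log (T (k + 1)) - T k * Real.log (T k)) -
        lam k * Real.log (partialWeight lam k) := fun k => by
    have h1 : 1 - lam k / partialWeight lam k = T k / partialWeight lam k := by
      rw [← hTs k, eq_div_iff (by rw [hTs]; exact (hL k).ne'), sub_mul,
        div_mul_cancel₀ _ (by rw [hTs]; exact (hL k).ne')]
      ring
    have hl := (hlam k).ne'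
    have hLk := (hL k).ne'
    rw [h1, hTL]
    -- When `T k = 0`, the convention `log 0 = 0` makes both sides vanish.
    rcases (hT0 k).eq_or_lt with h0 | h0
    · have := hTs k
      rw [← h0, zero_add] at this
      simp [← h0, this]
    · rw [Real.log_div h0.ne' hLk]
      have : lam k = partialWeight lam k - T k := by linarith [hTs k]
      field_simp
      rw [this]
      ring
  rw [Finset.sum_congr rfl fun k _ => hterm k, Finset.sum_sub_distrib,
    Finset.sum_range_sub (fun k => T k * Real.log (T k)), hTL]
  have : T 0 = 0 := by simp [hT]
  rw [this, zero_mul, sub_zero, sub_div]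
  congr 1
  exact mul_div_cancel_left₀ _ (hL n).ne'

lemma tendsto_giniMean_zero_inv_partialWeight (hlam : ∀ n, 0 < lam n)
    (hdiv : Tendsto (partialWeight lam) atTop atTop) {η : ℝ} (hη0 : 0 ≤ η) (hη1 : η < 1)
    (hlim : Tendsto (fun n => lam n / partialWeight lam n) atTop (𝓝 η)) :
    Tendsto (fun n => partialWeight lam n *
      prefixMean (giniMean 0 0) lam (fun k => (partialWeight lam k)⁻¹) n) atTop
      (𝓝 (if η = 0 then Real.exp 1 else (1 - η) ^ (1 - 1 / η))) := by
  have hL := partialWeight_pos hlam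
  have h := (Real.continuous_exp.tendsto _).comp (tendsto_log_average hlam hdiv hη0 hη1 hlim)
  have hc : Real.exp (if η = 0 then 1 else (1 - 1 / η) * Real.log (1 - η)) =
      if η = 0 then Real.exp 1 else (1 - η) ^ (1 - 1 / η) := by
    split_ifs
    · rfl
    · rw [Real.rpow_def_of_pos (sub_pos.2 hη1), mul_comm]
  rw [hc] at h
  refine h.congr fun n => ?_
  have h1 : ∑ i : Fin (n + 1), lam i = partialWeight lam n :=
    (Finset.sum_range (n := n + 1) lam).symm
  have h2 : ∑ i : Fin (n + 1), lam i * Real.log (partialWeight lam i) =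
      ∑ k ∈ Finset.range (n + 1), lam k * Real.log (partialWeight lam k) :=
    (Finset.sum_range fun k => lam k * Real.log (partialWeight lam k)).symm
  simp only [Function.comp, prefixMean, giniMean, if_true, Real.rpow_zero, mul_one, Real.log_inv,
    mul_neg, Finset.sum_neg_distrib, h1, h2]
  rw [sub_eq_add_neg, Real.exp_add, Real.exp_log (hL n), neg_div]

end Weights

/-! ### Assembling the constants -/

lemma powerConstant_div_powerConstant (η p q : ℝ) :
    powerConstant η (1 - p) / powerConstant η (1 - q) =
      if η = 0 then (1 - q) / (1 - p) else (1 - (1 - η) ^ (1 - q)) / (1 - (1 - η) ^ (1 - p)) := by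
  unfold powerConstant
  split_ifs with h
  · rw [div_div_div_eq, one_mul, mul_one]
  · rw [div_div_div_eq, mul_comm η, mul_div_mul_right _ _ h]

lemma isHardyConstant_giniMean_of_lt {lam : ℕ → ℝ} (hlam : lam ∈ weightSequences)
    (hdiv : Tendsto (partialWeight lam) atTop atTop)
    (hanti : Antitone fun n => lam n / partialWeight lam n) {η : ℝ} (hη0 : 0 ≤ η) (hη1 : η < 1)
    (hlim : Tendsto (fun n => lam n / partialWeight lam n) atTop (𝓝 η))
    {p q : ℝ} (hqp : q < p) (hq : q ≤ 0) (hp0 : 0 ≤ p) (hp1 : p < 1) :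
    IsHardyConstant (Set.Ioi 0) (giniMean p q) lam (ENNReal.ofReal
      ((powerConstant η (1 - p) / powerConstant η (1 - q)) ^ (1 / (p - q)))) := by
  have hpos := weight_pos hlam hdiv hanti
  refine (isDeviationMean_giniMean hqp).isHardyConstant (concaveOn_rpow_sub_rpow hq hp0 hp1.le)
    (monotoneOn_rpow_sub_rpow hq hp0) hpos hdiv hanti (Real.rpow_pos_of_pos ?_ _)
    (tendsto_giniMean_inv_partialWeight hpos hdiv hη0 hη1 hlim hqp hp1)
  exact div_pos (powerConstant_pos hη0 hη1.le (sub_pos.2 hp1))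
    (powerConstant_pos hη0 hη1.le (sub_pos.2 (hqp.trans hp1)))

lemma IsHardyConstant.congr {I : Set ℝ} {M N : (n : ℕ) → (Fin n → ℝ) → (Fin n → ℝ) → ℝ}
    {lam : ℕ → ℝ} {C : ℝ≥0∞} (h : IsHardyConstant I M lam C)
    (hMN : ∀ x : ℕ → ℝ, (∀ n, x n ∈ I) → ∀ n, prefixMean M lam x n = prefixMean N lam x n) :
    IsHardyConstant I N lam C := by
  unfold IsHardyConstant at h ⊢
  convert h using 5 with K x hx
  exact iff_of_eq (by
    congr 3
    funext n
    exact congrArg (fun t => ENNReal.ofReal (lam n * t)) (hMN x hx n).symm)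

theorem mainTheorem3 (lam : ℕ → ℝ) (hlam : lam ∈ weightSequences)
    (hdiv : Tendsto (partialWeight lam) atTop atTop)
    (hanti : Antitone fun n => lam n / partialWeight lam n)
    (η : ℝ) (hη0 : 0 ≤ η) (hη1 : η < 1)
    (hlim : Tendsto (fun n => lam n / partialWeight lam n) atTop (𝓝 η))
    (p q : ℝ) (hmin : min p q ≤ 0) (hmax0 : 0 ≤ max p q) (hmax1 : max p q < 1) :
    IsHardyConstant (Set.Ioi 0) (giniMean p q) lam
      (ENNReal.ofReal
        (if p = q then
          if η = 0 then Real.exp 1 else (1 - η) ^ (1 - 1 / η)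
        else
          if η = 0 then ((1 - q) / (1 - p)) ^ (1 / (p - q))
          else ((1 - (1 - η) ^ (1 - q)) / (1 - (1 - η) ^ (1 - p))) ^ (1 / (p - q)))) := by
  have hpos := weight_pos hlam hdiv hanti
  have hconst : ∀ a b : ℝ, (powerConstant η (1 - a) / powerConstant η (1 - b)) ^ (1 / (a - b)) =
      if η = 0 then ((1 - b) / (1 - a)) ^ (1 / (a - b))
      else ((1 - (1 - η) ^ (1 - b)) / (1 - (1 - η) ^ (1 - a))) ^ (1 / (a - b)) := fun a b => by
    rw [powerConstant_div_powerConstant]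
    split_ifs <;> rfl
  rcases lt_trichotomy q p with h | h | h
  · rw [min_eq_right h.le] at hmin
    rw [max_eq_left h.le] at hmax0 hmax1
    rw [if_neg h.ne', ← hconst]
    exact isHardyConstant_giniMean_of_lt hlam hdiv hanti hη0 hη1 hlim h hmin hmax0 hmax1
  · subst h
    rw [min_self] at hmin
    rw [max_self] at hmax0
    obtain rfl : q = 0 := le_antisymm hmin hmax0
    rw [if_pos rfl]
    refine isDeviationMean_giniMean_zero.isHardyConstant strictConcaveOn_log_Ioi.concaveOn
      Real.strictMonoOn_log.monotoneOn hpos hdiv hanti ?_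
      (tendsto_giniMean_zero_inv_partialWeight hpos hdiv hη0 hη1 hlim)
    split_ifs
    · exact Real.exp_pos 1
    · exact Real.rpow_pos_of_pos (sub_pos.2 hη1) _
  -- Both the mean and the constant are symmetric in `p` and `q`.
  · rw [min_eq_left h.le] at hmin
    rw [max_eq_right h.le] at hmax0 hmax1
    have hP : 0 < powerConstant η (1 - p) :=
      powerConstant_pos hη0 hη1.le (sub_pos.2 (h.trans hmax1))
    have hQ : 0 < powerConstant η (1 - q) := powerConstant_pos hη0 hη1.le (sub_pos.2 hmax1)
    have hsymm : (powerConstant η (1 - p) / powerConstant η (1 - q)) ^ (1 / (p - q)) =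
        (powerConstant η (1 - q) / powerConstant η (1 - p)) ^ (1 / (q - p)) := by
      rw [← inv_div, Real.inv_rpow (div_pos hQ hP).le, ← Real.rpow_neg (div_pos hQ hP).le,
        ← neg_sub q p, div_neg, neg_neg]
    rw [if_neg h.ne, ← hconst, hsymm]
    exact (isHardyConstant_giniMean_of_lt hlam hdiv hanti hη0 hη1 hlim h hmin hmax0 hmax1).congr
      fun x hx n => giniMean_comm q p _ _ _ (fun i => hx i) fun i => (hpos i).le
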